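/- Let $S_4$ be the symmetric group on $\{1,2,3,4\}$ and let $H=\langle (12),(34)\rangle\subseteq S_4$ be the subgroup generated by the transpositions $(12)$ and $(34)$. Then $H\cong S_2\times S_2$, and the restriction map on group cohomology $$\mathrm{Res}^{S_4}_{H}\colon H^4(S_4,\mathbb{C}^\times)\to H^4(H,\mathbb{C}^\times)$$ is injective, where $S_4$ and $H$ act trivially on the coefficient group $\mathbb{C}^\times$. -/

import Mathlib

/-- The subgroup `⟨(12), (34)⟩` of `S₄`, where `S₄` is the group of permutations of
`Fin 4 = {0, 1, 2, 3}`, so that the letters `1, 2, 3, 4` are written `0, 1, 2, 3`. -/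
def youngSubgroupS2S2 : Subgroup (Equiv.Perm (Fin 4)) :=
  Subgroup.closure {Equiv.swap 0 1, Equiv.swap 2 3}

/-- `ℂˣ` (written additively) as a `G`-module with trivial action. -/
noncomputable abbrev trivialCUnits (G : Type) [Group G] : Rep ℤ G :=
  Rep.trivial ℤ G (Additive ℂˣ)

/-- The restriction map `Hⁿ(G, ℂˣ) → Hⁿ(K, ℂˣ)` for a subgroup `K` of `G`, the action on `ℂˣ`
being trivial: it is induced by the inclusion `K → G` and the identity of `ℂˣ`, that is, it
sends the class of a cocycle on `G` to the class of its restriction to `K`. -/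
noncomputable def resCUnits {G : Type} [Group G] (K : Subgroup G) (n : ℕ) :
    groupCohomology (trivialCUnits G) n ⟶ groupCohomology (trivialCUnits K) n :=
  groupCohomology.map K.subtype
    (Rep.ofHom (Representation.IntertwiningMap.id (trivialCUnits K).ρ)) n

/-!
The group `S₄` is the rotation group of the cube, hence acts on the sphere and preserves its
orientation. The cochains of an equivariant cell structure with one orbit of vertices for each of
the stabilizers `C₄`, `C₃`, `C₂`, and free orbits of edges and of faces, form an exact sequence
`0 ⟶ ℂˣ ⟶ X₀ ⟶ X₁ ⟶ X₂ ⟶ ℂˣ ⟶ 0` of `S₄`-modules. By Shapiro's lemma `H⁴(S₄, X₀)` is the sum of the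
groups `H⁴(C_k, ℂˣ)`, which vanish because `ℂˣ` is divisible and `4` is even, and `X₁`, `X₂` are
acyclic. Dimension shifting therefore gives a surjection of `H¹(S₄, ℂˣ)` onto `H⁴(S₄, ℂˣ)`
(`exists_surjective_H1_H4`). As `H¹(S₄, ℂˣ)` consists of the trivial and the sign character, any two
nonzero classes in `H⁴(S₄, ℂˣ)` agree (`eq_of_H4_ne_zero`), and it suffices to find one class whose
restriction to `⟨(12), (34)⟩` is nonzero.

Such a class is `(-1) ^ (s ∪ s ∪ c)`, where `s` is the parity and `c` the 2-cocycle of the extension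
`GL₂(𝔽₃)` of `PGL₂(𝔽₃) = S₄` by `{±1}`. Its restriction is nonzero because its value on an explicit
4-cycle, the shuffle product of a 1-cycle and a 3-cycle of the two factors, is `-1`
(`exists_resCUnits_ne_zero`).
-/

open CategoryTheory Limits

/-! ### Dimension shifting and acyclic modules -/

/-- An exact sequence `0 ⟶ K ⟶ X ⟶ Y ⟶ Z` yields a short exact sequence
`0 ⟶ K ⟶ X ⟶ ker (Y ⟶ Z) ⟶ 0`. -/
lemma shortExact_kernel_lift {C : Type*} [Category C] [Abelian C] {K X Y Z : C}
    {i : K ⟶ X} {f : X ⟶ Y} {g : Y ⟶ Z} (hif : i ≫ f = 0) (hfg : f ≫ g = 0) [Mono i]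
    (hX : (ShortComplex.mk i f hif).Exact) (hY : (ShortComplex.mk f g hfg).Exact) :
    (ShortComplex.mk i (kernel.lift g f hfg) (by
      rw [← cancel_mono (kernel.ι g)]; simpa using hif)).ShortExact := by
  have hepi : Epi (kernel.lift g f hfg) :=
    (ShortComplex.exact_iff_epi_kernel_lift _).1 hY
  refine ShortComplex.ShortExact.mk ?_
  rw [ShortComplex.exact_iff_epi_kernel_lift] at hX ⊢
  let e : kernel (kernel.lift g f hfg) ≅ kernel f :=
    (kernelCompMono (kernel.lift g f hfg) (kernel.ι g)).symm ≪≫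
      kernelIsoOfEq (kernel.lift_ι g f hfg)
  have : kernel.lift (kernel.lift g f hfg) i (by
      rw [← cancel_mono (kernel.ι g)]; simpa using hif) = kernel.lift f i hif ≫ e.inv := by
    rw [← cancel_mono (kernel.ι _)]
    simp [e]
  dsimp at *
  rw [this]
  infer_instance

namespace Rep

variable {k G : Type} [CommRing k] [Group G]

lemma exact_of_function_exact {X Y Z : Rep.{0} k G} {f : X ⟶ Y} {g : Y ⟶ Z} (w : f ≫ g = 0)
    (h : Function.Exact f.hom g.hom) : (ShortComplex.mk f g w).Exact := by
  rw [← (ShortComplex.mk f g w).exact_map_iff_of_faithful (forget₂ (Rep k G) (ModuleCat k))]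
  rw [ShortComplex.moduleCat_exact_iff]
  intro y hy
  exact (h y).1 hy

end Rep

namespace groupCohomology

variable {k G : Type} [CommRing k] [Group G]

instance functor_additive (n : ℕ) : (functor k G n).Additive :=
  inferInstanceAs ((cochainsFunctor k G ⋙ HomologicalComplex.homologyFunctor _ _ n).Additive)

lemma isZero_prod {V W : Type} [AddCommGroup V] [AddCommGroup W] [Module k V] [Module k W]
    {ρ : Representation k G V} {σ : Representation k G W} {n : ℕ}
    (hV : IsZero (groupCohomology (Rep.of ρ) n)) (hW : IsZero (groupCohomology (Rep.of σ) n)) :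
    IsZero (groupCohomology (Rep.of (ρ.prod σ)) n) := by
  let F := functor k G n
  have h : 𝟙 (Rep.of (ρ.prod σ)) =
      Rep.ofHom (.fst k ρ σ) ≫ Rep.ofHom (.inl k ρ σ) +
        Rep.ofHom (.snd k ρ σ) ≫ Rep.ofHom (.inr k ρ σ) := by
    refine Rep.hom_ext (Representation.IntertwiningMap.ext (LinearMap.ext fun x ↦ ?_))
    change x = (x.1, 0) + (0, x.2)
    simp
  have h' := congrArg F.map h
  rw [F.map_id, F.map_add, F.map_comp, F.map_comp,
    (show IsZero (F.obj (Rep.of ρ)) from hV).eq_zero_of_tgt (F.map _),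
    (show IsZero (F.obj (Rep.of σ)) from hW).eq_zero_of_tgt (F.map _), zero_comp, zero_comp,
    add_zero] at h'
  exact (IsZero.iff_id_eq_zero _).2 h'

lemma surjective_δ_of_isZero {S : ShortComplex (Rep.{0} k G)} (hS : S.ShortExact) (n : ℕ)
    (h : IsZero (groupCohomology S.X₂ (n + 1))) :
    Function.Surjective (δ hS n (n + 1) rfl).hom :=
  (ModuleCat.epi_iff_surjective _).1 (epi_δ_of_isZero hS n h)

/-- Dimension shifting along a four-term exact sequence: if `0 ⟶ A ⟶ X₀ ⟶ X₁ ⟶ X₂ ⟶ B ⟶ 0` is exact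
and the cohomology of the middle terms vanishes in the relevant degrees, then the composite of
three connecting homomorphisms `Hⁿ(G, B) ⟶ Hⁿ⁺³(G, A)` is surjective. -/
theorem exists_surjective_of_exact {A X₀ X₁ X₂ B : Rep.{0} k G}
    (i : A ⟶ X₀) (d₀ : X₀ ⟶ X₁) (d₁ : X₁ ⟶ X₂) (p : X₂ ⟶ B)
    (hi : Function.Injective i.hom) (h₀ : Function.Exact i.hom d₀.hom)
    (h₁ : Function.Exact d₀.hom d₁.hom) (h₂ : Function.Exact d₁.hom p.hom)
    (hp : Function.Surjective p.hom) (n : ℕ)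
    (z₀ : IsZero (groupCohomology X₀ (n + 3))) (z₁ : IsZero (groupCohomology X₁ (n + 2)))
    (z₂ : IsZero (groupCohomology X₂ (n + 1))) :
    ∃ φ : groupCohomology B n →ₗ[k] groupCohomology A (n + 3), Function.Surjective φ := by
  have w₀ : i ≫ d₀ = 0 := by ext x; exact h₀.apply_apply_eq_zero x
  have w₁ : d₀ ≫ d₁ = 0 := by ext x; exact h₁.apply_apply_eq_zero x
  have w₂ : d₁ ≫ p = 0 := by ext x; exact h₂.apply_apply_eq_zero x
  have : Mono i := (Rep.mono_iff_injective i).2 hi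
  have : Epi p := (Rep.epi_iff_surjective p).2 hp
  have S₀ := shortExact_kernel_lift w₀ w₁ (Rep.exact_of_function_exact w₀ h₀)
    (Rep.exact_of_function_exact w₁ h₁)
  have S₁ := shortExact_kernel_lift (kernel.condition d₁) w₂ (ShortComplex.exact_kernel d₁)
    (Rep.exact_of_function_exact w₂ h₂)
  have S₂ : (ShortComplex.mk (kernel.ι p) p (kernel.condition p)).ShortExact :=
    ShortComplex.ShortExact.mk (ShortComplex.exact_kernel p)
  refine ⟨(δ S₀ (n + 2) (n + 3) rfl).hom ∘ₗ (δ S₁ (n + 1) (n + 2) rfl).hom ∘ₗ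
    (δ S₂ n (n + 1) rfl).hom, ?_⟩
  exact (surjective_δ_of_isZero S₀ _ z₀).comp
    ((surjective_δ_of_isZero S₁ _ z₁).comp (surjective_δ_of_isZero S₂ _ z₂))

open Rep.FiniteCyclicGroup in
/-- For even `n > 0`, the group `Hⁿ` of a finite cyclic group `C` with trivial coefficients `M` is
`M / |C|M`. -/
lemma isZero_trivial_of_even {C : Type} [CommGroup C] [Finite C] (g : C)
    (hg : ∀ x, x ∈ Subgroup.zpowers g) (M : Type) [AddCommGroup M]
    (hM : ∀ m : M, ∃ m' : M, Nat.card C • m' = m) (n : ℕ) [NeZero n] (hn : Even n) :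
    IsZero (groupCohomology (Rep.trivial ℤ C M) n) := by
  have := Fintype.ofFinite C
  refine IsZero.of_iso ?_ (groupCohomologyIsoEven (Rep.trivial ℤ C M) g hg n hn)
  rw [← ShortComplex.exact_iff_isZero_homology, ShortComplex.moduleCat_exact_iff]
  intro m _
  obtain ⟨m', rfl⟩ := hM m
  refine ⟨m', ?_⟩
  change (Representation.norm (Representation.trivial ℤ C M)) m' = _
  simp [Representation.norm, Nat.card_eq_fintype_card]

lemma isZero_coind_zpowers {G : Type} [Group G] [Finite G] (g : G) (M : Type) [AddCommGroup M]
    (hM : ∀ m : M, ∃ m' : M, orderOf g • m' = m) (n : ℕ) [NeZero n] (hn : Even n) :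
    IsZero (groupCohomology (Rep.coind (Subgroup.zpowers g).subtype
      (Rep.trivial ℤ (Subgroup.zpowers g) M)) n) := by
  refine IsZero.of_iso ?_ (coindIso _ n)
  let _ : CommGroup (Subgroup.zpowers g) :=
    { (inferInstance : Group (Subgroup.zpowers g)) with mul_comm := mul_comm' }
  refine isZero_trivial_of_even (⟨g, Subgroup.mem_zpowers g⟩ : Subgroup.zpowers g) ?_ M ?_ n hn
  · rintro ⟨x, k, rfl⟩
    exact ⟨k, Subtype.ext (by simp)⟩
  · simpa [Nat.card_zpowers] using hM

lemma isZero_coind_bot {G : Type} [Group G] (M : Type) [AddCommGroup M] (n : ℕ) :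
    IsZero (groupCohomology (Rep.coind (⊥ : Subgroup G).subtype
      (Rep.trivial ℤ (⊥ : Subgroup G) M)) (n + 1)) :=
  (isZero_groupCohomology_succ_of_subsingleton _ n).of_iso (coindIso _ (n + 1))

end groupCohomology

/-! ### Cochains of an equivariant cell structure on the sphere -/

namespace SphereComplex

variable {G : Type} [Group G] (M : Type) [AddCommGroup M]

/-- The `G`-module of `M`-valued functions on `C \ G`, that is, of functions on `G` invariant under
left translation by `C`; the group `G` acts by right translation. -/
abbrev orbitFun (C : Subgroup G) : Representation ℤ G
    (Representation.coindV C.subtype (Representation.trivial ℤ C M)) :=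
  Representation.coind C.subtype (Representation.trivial ℤ C M)

variable {M}

lemma apply_mul_left {C : Subgroup G}
    (f : Representation.coindV C.subtype (Representation.trivial ℤ C M)) {c : G} (hc : c ∈ C)
    (g : G) : f.1 (c * g) = f.1 g :=
  f.2 ⟨c, hc⟩ g

/-- A function on `G`, seen as a function on the quotient by the trivial subgroup. -/
def ofFun (u : G → M) : Representation.coindV (⊥ : Subgroup G).subtype
    (Representation.trivial ℤ (⊥ : Subgroup G) M) :=
  ⟨u, fun c g ↦ by
    obtain ⟨c, hc⟩ := c
    obtain rfl := Subgroup.mem_bot.1 hc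
    simp⟩

lemma ofFun_sum {ι : Type*} (s : Finset ι) (u : ι → G → M) :
    ofFun (∑ i ∈ s, u i) = ∑ i ∈ s, ofFun (u i) :=
  Subtype.ext (by rw [AddSubmonoidClass.coe_finsetSum]; rfl)

variable (M) (x z : G)

/-- Functions on the vertices of the cell complex attached to two elements `x`, `z` of `G`: there
is one orbit of vertices for each of the stabilizers `⟨x⟩`, `⟨xz⁻¹⟩`, `⟨z⟩`. -/
noncomputable abbrev vertexFun := (orbitFun M (Subgroup.zpowers x)).prod
  ((orbitFun M (Subgroup.zpowers (x * z⁻¹))).prod (orbitFun M (Subgroup.zpowers z)))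

/-- Functions on the edges: the `g`-th edge of the first free orbit joins the cosets of `g` modulo
`⟨xz⁻¹⟩` and `⟨x⟩`, that of the second one joins those modulo `⟨z⟩` and `⟨xz⁻¹⟩`. -/
noncomputable abbrev edgeFun := (orbitFun M (⊥ : Subgroup G)).prod (orbitFun M (⊥ : Subgroup G))

/-- The inclusion of the constant functions. -/
noncomputable def augmentation : (Representation.trivial ℤ G M).IntertwiningMap (vertexFun M x z) where
  toFun m := (⟨fun _ ↦ m, fun _ _ ↦ rfl⟩, ⟨fun _ ↦ m, fun _ _ ↦ rfl⟩, ⟨fun _ ↦ m, fun _ _ ↦ rfl⟩)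
  map_add' _ _ := rfl
  map_smul' _ _ := rfl
  isIntertwining' _ := rfl

/-- The coboundary from vertices to edges. -/
noncomputable def dVertex : (vertexFun M x z).IntertwiningMap (edgeFun (G := G) M) where
  toFun f := (ofFun (f.1.1 - f.2.1.1), ofFun (f.2.1.1 - f.2.2.1))
  map_add' f f' := by
    refine Prod.ext ?_ ?_ <;> refine Subtype.ext (funext fun g ↦ ?_) <;>
      exact add_sub_add_comm _ _ _ _
  map_smul' n f := by
    refine Prod.ext ?_ ?_ <;> refine Subtype.ext (funext fun g ↦ ?_) <;>
      exact (smul_sub n _ _).symm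
  isIntertwining' _ := rfl

/-- The coboundary from edges to faces. The faces form one free orbit of quadrilaterals: the
`g`-th one has as its vertices the cosets of `g` modulo `⟨x⟩`, `⟨xz⁻¹⟩`, `⟨z⟩`, and the common
coset of `x * g` and `z * g` modulo `⟨xz⁻¹⟩`. -/
noncomputable def dEdge : (edgeFun (G := G) M).IntertwiningMap (orbitFun M (⊥ : Subgroup G)) where
  toFun u := ofFun fun g ↦ u.1.1 g + u.2.1 g - u.2.1 (z * g) - u.1.1 (x * g)
  map_add' u v := by
    refine Subtype.ext (funext fun g ↦ ?_)
    change u.1.1 g + v.1.1 g + (u.2.1 g + v.2.1 g) - (u.2.1 (z * g) + v.2.1 (z * g)) -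
      (u.1.1 (x * g) + v.1.1 (x * g)) = u.1.1 g + u.2.1 g - u.2.1 (z * g) - u.1.1 (x * g) +
      (v.1.1 g + v.2.1 g - v.2.1 (z * g) - v.1.1 (x * g))
    abel
  map_smul' n u := by
    refine Subtype.ext (funext fun g ↦ ?_)
    change n • u.1.1 g + n • u.2.1 g - n • u.2.1 (z * g) - n • u.1.1 (x * g) =
      n • (u.1.1 g + u.2.1 g - u.2.1 (z * g) - u.1.1 (x * g))
    simp only [smul_sub, smul_add]
  isIntertwining' h := by
    refine LinearMap.ext fun u ↦ Subtype.ext (funext fun g ↦ ?_)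
    change u.1.1 (g * h) + u.2.1 (g * h) - u.2.1 (z * g * h) - u.1.1 (x * g * h) =
      u.1.1 (g * h) + u.2.1 (g * h) - u.2.1 (z * (g * h)) - u.1.1 (x * (g * h))
    simp only [mul_assoc]

/-- Summation over all faces. -/
noncomputable def integral [Fintype G] : (orbitFun M (⊥ : Subgroup G)).IntertwiningMap
    (Representation.trivial ℤ G M) where
  toFun w := ∑ g, w.1 g
  map_add' u v := by simp [Finset.sum_add_distrib]
  map_smul' n u := by simp [Finset.smul_sum]
  isIntertwining' h := LinearMap.ext fun w ↦ Equiv.sum_comp (Equiv.mulRight h) w.1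

variable {M}

lemma eq_of_closure {α : Type*} {S : Set G} (hS : Subgroup.closure S = ⊤) {f : G → α}
    (hf : ∀ s ∈ S, ∀ g, f (s * g) = f g) (g : G) : f g = f 1 := by
  have h : ∀ a ∈ Subgroup.closure S, ∀ g, f (a * g) = f g := by
    intro a ha
    induction ha using Subgroup.closure_induction with
    | mem s hs => exact hf s hs
    | one => simp
    | mul a b _ _ iha ihb => intro g; rw [mul_assoc, iha, ihb]
    | inv a _ iha => intro g; rw [← iha, mul_inv_cancel_left]
  simpa using h g (hS ▸ Subgroup.mem_top g) 1

variable {x z} (hxz : Subgroup.closure {x, z} = ⊤)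
include hxz

lemma exact_augmentation : Function.Exact (augmentation M x z) (dVertex M x z) := by
  intro f
  constructor
  · intro h
    have h₁ : f.1.1 = f.2.1.1 := sub_eq_zero.1 (congrArg (fun u ↦ u.1.1) h)
    have h₂ : f.2.1.1 = f.2.2.1 := sub_eq_zero.1 (congrArg (fun u ↦ u.2.1) h)
    have hc : ∀ g, f.1.1 g = f.1.1 1 := by
      refine eq_of_closure hxz fun s hs g ↦ ?_
      obtain rfl | rfl := hs
      · exact apply_mul_left f.1 (Subgroup.mem_zpowers _) g
      · rw [h₁, h₂]
        exact apply_mul_left f.2.2 (Subgroup.mem_zpowers _) g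
    refine ⟨f.1.1 1, Prod.ext ?_ (Prod.ext ?_ ?_)⟩
    · exact Subtype.ext (funext fun g ↦ (hc g).symm)
    · exact Subtype.ext (funext fun g ↦ by rw [← h₁]; exact (hc g).symm)
    · exact Subtype.ext (funext fun g ↦ by rw [← h₂, ← h₁]; exact (hc g).symm)
  · rintro ⟨m, rfl⟩
    refine Prod.ext ?_ ?_ <;> exact Subtype.ext (funext fun _ ↦ sub_self m)

lemma exact_integral [Fintype G] : Function.Exact (dEdge M x z) (integral (G := G) M) := by
  classical
  intro w
  constructor
  · intro hw
    let R := LinearMap.range (dEdge M x z).toLinearMap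
    have key (m : M) (g : G) : ofFun (Pi.single g m) - ofFun (Pi.single 1 m) ∈ R := by
      have : (R.mkQ (ofFun (Pi.single g m))) = R.mkQ (ofFun (Pi.single 1 m)) := by
        refine eq_of_closure hxz (f := fun g ↦ R.mkQ (ofFun (Pi.single g m))) ?_ g
        intro s hs g
        rw [← sub_eq_zero, ← map_sub, Submodule.mkQ_apply, Submodule.Quotient.mk_eq_zero]
        obtain rfl | rfl := hs
        · refine ⟨(ofFun (Pi.single (s * g) m), 0), Subtype.ext (funext fun a ↦ ?_)⟩
          change (Pi.single (s * g) m : G → M) a + 0 - 0 - (Pi.single (s * g) m : G → M) (s * a) =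
            (Pi.single (s * g) m : G → M) a - (Pi.single g m : G → M) a
          simp [Pi.single_apply]
        · refine ⟨(0, ofFun (Pi.single (s * g) m)), Subtype.ext (funext fun a ↦ ?_)⟩
          change 0 + (Pi.single (s * g) m : G → M) a - (Pi.single (s * g) m : G → M) (s * a) - 0 =
            (Pi.single (s * g) m : G → M) a - (Pi.single g m : G → M) a
          simp [Pi.single_apply]
      rwa [← sub_eq_zero, ← map_sub, Submodule.mkQ_apply, Submodule.Quotient.mk_eq_zero] at this
    have hw' : w = ∑ g, (ofFun (Pi.single g (w.1 g)) - ofFun (Pi.single 1 (w.1 g))) := by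
      have h0 : ∑ g, w.1 g = 0 := hw
      have h1 : ∑ g, ofFun (Pi.single (1 : G) (w.1 g)) = 0 := by
        have := map_sum (AddMonoidHom.single (fun _ : G ↦ M) 1) w.1 Finset.univ
        simp only [AddMonoidHom.single_apply] at this
        rw [← ofFun_sum, ← this, h0, Pi.single_zero]
        rfl
      rw [Finset.sum_sub_distrib, h1, sub_zero, ← ofFun_sum, Finset.univ_sum_single]
      rfl
    rw [hw']
    exact Submodule.sum_mem _ fun g _ ↦ key _ _
  · rintro ⟨u, rfl⟩
    change ∑ g, (u.1.1 g + u.2.1 g - u.2.1 (z * g) - u.1.1 (x * g)) = 0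
    have h₁ : ∑ g, u.2.1 (z * g) = ∑ g, u.2.1 g := Equiv.sum_comp (Equiv.mulLeft z) u.2.1
    have h₂ : ∑ g, u.1.1 (x * g) = ∑ g, u.1.1 g := Equiv.sum_comp (Equiv.mulLeft x) u.1.1
    simp only [Finset.sum_add_distrib, Finset.sum_sub_distrib, h₁, h₂]
    abel

omit hxz

lemma integral_surjective [Fintype G] : Function.Surjective (integral (G := G) M) := by
  classical
  intro m
  refine ⟨ofFun (Pi.single 1 m), ?_⟩
  change ∑ g, (Pi.single 1 m : G → M) g = m
  simp

lemma augmentation_injective : Function.Injective (augmentation M x z) := fun _ _ h ↦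
  congrFun (congrArg (fun f ↦ f.1.1) h) 1

/-- Exactness at the edges reduces to a statement on functions on `G`: a function `β` that obeys
the relations of `x ^ n = 1` and `z ^ 2 = 1` has a potential on the vertices of type `⟨xz⁻¹⟩`. Such a
potential determines the values at the other two types of vertices. -/
lemma exact_dVertex (hz : z * z = 1) (n : ℕ) (hx : x ^ n = 1)
    (H : ∀ β : G → M, (∀ g, β (z * g) = -β g) → (∀ g, ∑ i ∈ Finset.range n, β (x ^ i * g) = 0) →
      ∃ f : G → M, (∀ g, f (x * g) - f g = β g) ∧ ∀ g, f (x * z⁻¹ * g) = f g) :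
    Function.Exact (dVertex M x z) (dEdge M x z) := by
  intro u
  constructor
  · intro hu
    have hu' (g : G) : u.1.1 g - u.1.1 (x * g) = u.2.1 (z * g) - u.2.1 g := by
      have : u.1.1 g + u.2.1 g - u.2.1 (z * g) - u.1.1 (x * g) = 0 :=
        congrFun (congrArg Subtype.val hu) g
      rw [← sub_eq_zero, ← this]
      abel
    obtain ⟨f, hf, hfy⟩ := H (fun g ↦ u.1.1 g - u.1.1 (x * g)) (fun g ↦ by
        simp only [hu', ← mul_assoc z z, hz, one_mul]; abel) (fun g ↦ by
        have := Finset.sum_range_sub' (fun i ↦ u.1.1 (x ^ i * g)) n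
        simpa [pow_succ', mul_assoc, hx] using this)
    have mem {c : G} {e : G → M} (he : ∀ g, e (c * g) = e g) :
        e ∈ Representation.coindV (Subgroup.zpowers c).subtype
          (Representation.trivial ℤ (Subgroup.zpowers c) M) := by
      rintro ⟨a, ha⟩ g
      have h : ∀ b ∈ Subgroup.closure {c}, ∀ g, e (b * g) = e g := by
        intro b hb
        induction hb using Subgroup.closure_induction with
        | mem s hs => rw [Set.mem_singleton_iff.1 hs]; exact he
        | one => simp
        | mul a b _ _ iha ihb => intro g; rw [mul_assoc, iha, ihb]
        | inv a _ iha => intro g; rw [← iha, mul_inv_cancel_left]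
      exact h a (Subgroup.zpowers_eq_closure c ▸ ha) g
    have hfz (g : G) : f (z * g) = f (x * g) := by simpa [mul_assoc] using (hfy (z * g)).symm
    refine ⟨(⟨u.1.1 + f, mem fun g ↦ ?_⟩, ⟨f, mem hfy⟩, ⟨f - u.2.1, mem fun g ↦ ?_⟩), ?_⟩
    · have := hf g
      simp only [Pi.add_apply]
      rw [← sub_eq_zero, ← sub_eq_zero.2 this]
      abel
    · have := hf g
      simp only [Pi.sub_apply, hfz]
      rw [sub_eq_iff_eq_add.1 this, ← sub_eq_zero, ← sub_eq_zero.2 (hu' g)]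
      abel
    · refine Prod.ext ?_ ?_ <;> refine Subtype.ext (funext fun g ↦ ?_)
      · exact add_sub_cancel_right _ _
      · exact sub_sub_cancel _ _
  · rintro ⟨f, rfl⟩
    refine Subtype.ext (funext fun g ↦ ?_)
    change f.1.1 g - f.2.1.1 g + (f.2.1.1 g - f.2.2.1 g) - (f.2.1.1 (z * g) - f.2.2.1 (z * g)) -
      (f.1.1 (x * g) - f.2.1.1 (x * g)) = 0
    rw [apply_mul_left f.1 (Subgroup.mem_zpowers x), apply_mul_left f.2.2 (Subgroup.mem_zpowers z),
      show x * g = x * z⁻¹ * (z * g) by group, apply_mul_left f.2.1 (Subgroup.mem_zpowers _)]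
    abel

end SphereComplex

/-! ### The octahedral group -/

namespace OctahedralGroup

/-- A 4-cycle: a rotation of the cube about the axis through two opposite faces, the group `S₄`
being the rotation group of the cube, acting on its four diagonals. -/
abbrev quarterTurn : Equiv.Perm (Fin 4) := finRotate 4

/-- A transposition: a rotation of the cube about the axis through the midpoints of two opposite
edges. -/
abbrev halfTurn : Equiv.Perm (Fin 4) := Equiv.swap 0 1

lemma closure_turns : Subgroup.closure {quarterTurn, halfTurn} = ⊤ :=
  Equiv.Perm.closure_cycle_adjacent_swap (isCycle_finRotate (n := 2)) support_finRotate 0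

/-- The Poincaré lemma for the surface of the cube. The vertices of the cube are two copies of the
set of its diagonals, `p` in the first copy and `q` in the second one being adjacent for `p ≠ q`,
and its faces are the 4-cycles of this graph that meet all four diagonals. -/
lemma exists_potential_of_antipodal {M : Type*} [AddCommGroup M] (γ : Fin 4 → Fin 4 → M)
    (h : ∀ p q r t : Fin 4, [p, q, r, t].Nodup → γ p q - γ r q + γ r t - γ p t = 0) :
    ∃ a b : Fin 4 → M, ∀ p q, p ≠ q → b q - a p = γ p q := by
  refine ⟨![0, γ 0 2 - γ 1 2, γ 0 1 - γ 2 1, γ 0 1 - γ 3 1],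
    ![γ 1 0 + (γ 0 2 - γ 1 2), γ 0 1, γ 0 2, γ 0 3], fun p q hpq ↦ ?_⟩
  -- The potential is given by paths that start at the vertex `0` of the first copy; the five
  -- edges off these paths are accounted for by five of the six faces.
  have h₁ := h 0 2 1 3 (by decide)
  have h₂ := h 0 1 2 3 (by decide)
  have h₃ := h 0 1 3 2 (by decide)
  have h₄ := h 1 0 2 3 (by decide)
  have h₅ := h 1 0 3 2 (by decide)
  fin_cases p <;> fin_cases q <;> first | exact absurd rfl hpq | simp <;> grind

/-- Directed edges of the cube, from the first copy of the diagonals to the second one, correspond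
to even permutations. -/
lemma exists_even (p q : Fin 4) (h : p ≠ q) :
    ∃ g : Equiv.Perm (Fin 4), g.sign = 1 ∧ g⁻¹ 1 = p ∧ g⁻¹ 0 = q := by
  revert p q; decide

lemma eq_one_of_even : ∀ k : Equiv.Perm (Fin 4), k.sign = 1 → k 0 = 0 → k 1 = 1 → k = 1 := by
  decide

lemma eq_of_even {g h : Equiv.Perm (Fin 4)} (hg : g.sign = 1) (hh : h.sign = 1)
    (h₁ : g⁻¹ 1 = h⁻¹ 1) (h₀ : g⁻¹ 0 = h⁻¹ 0) : g = h := by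
  rw [← mul_inv_eq_one]
  refine eq_one_of_even _ (by simp [hg, hh]) ?_ ?_
  · rw [Equiv.Perm.mul_apply, ← h₀]; exact g.apply_symm_apply 0
  · rw [Equiv.Perm.mul_apply, ← h₁]; exact g.apply_symm_apply 1

lemma exists_perm : ∀ p q r t : Fin 4, [p, q, r, t].Nodup → ∃ g : Equiv.Perm (Fin 4),
    g⁻¹ 1 = p ∧ g⁻¹ 0 = q ∧ g⁻¹ 3 = r ∧ g⁻¹ 2 = t := by decide

/-- A function on `S₄` that obeys the relations of `quarterTurn ^ 4 = 1` and `halfTurn ^ 2 = 1` is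
the coboundary, along `quarterTurn`, of a function on the vertices of the cube. The vertices are
the cosets of the 3-cycle `quarterTurn * halfTurn⁻¹`, which fixes the letter `1`: the coset of `g`
is determined by `g⁻¹ 1` and the sign of `g`. -/
lemma exists_potential {M : Type*} [AddCommGroup M] (β : Equiv.Perm (Fin 4) → M)
    (hz : ∀ g, β (halfTurn * g) = -β g)
    (hx : ∀ g, ∑ i ∈ Finset.range 4, β (quarterTurn ^ i * g) = 0) :
    ∃ f : Equiv.Perm (Fin 4) → M, (∀ g, f (quarterTurn * g) - f g = β g) ∧
      ∀ g, f (quarterTurn * halfTurn⁻¹ * g) = f g := by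
  have hex (p q : Fin 4) :
      ∃ g : Equiv.Perm (Fin 4), p ≠ q → g.sign = 1 ∧ g⁻¹ 1 = p ∧ g⁻¹ 0 = q := by
    by_cases h : p = q
    · exact ⟨1, fun h' ↦ absurd h h'⟩
    · exact (exists_even p q h).imp fun _ hg _ ↦ hg
  choose E hE using hex
  let γ (p q : Fin 4) : M := β (E p q)
  have even (g : Equiv.Perm (Fin 4)) (hg : g.sign = 1) : β g = γ (g⁻¹ 1) (g⁻¹ 0) := by
    have := hE (g⁻¹ 1) (g⁻¹ 0) (by simp)
    exact congrArg β (eq_of_even hg this.1 this.2.1.symm this.2.2.symm)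
  have odd (g : Equiv.Perm (Fin 4)) (hg : g.sign = -1) : β g = -γ (g⁻¹ 0) (g⁻¹ 1) := by
    rw [← neg_eq_iff_eq_neg, ← hz, even _ (by simp [hg])]
    simp [Equiv.swap_inv]
  have e₀ : (quarterTurn⁻¹ : Equiv.Perm (Fin 4)) 0 = 3 := by decide
  have e₁ : (quarterTurn⁻¹ : Equiv.Perm (Fin 4)) 1 = 0 := by decide
  have e₂ : (quarterTurn⁻¹ : Equiv.Perm (Fin 4)) 2 = 1 := by decide
  have e₃ : (quarterTurn⁻¹ : Equiv.Perm (Fin 4)) 3 = 2 := by decide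
  have sq : Equiv.Perm.sign quarterTurn = -1 := by decide
  have face_even (g : Equiv.Perm (Fin 4)) (hg : g.sign = 1) :
      γ (g⁻¹ 1) (g⁻¹ 0) - γ (g⁻¹ 3) (g⁻¹ 0) + γ (g⁻¹ 3) (g⁻¹ 2) - γ (g⁻¹ 1) (g⁻¹ 2) = 0 := by
    have := hx g
    simp only [Finset.sum_range_succ, Finset.sum_range_zero, zero_add] at this
    rw [even (quarterTurn ^ 0 * g) (by simp [hg]), odd (quarterTurn ^ 1 * g) (by simp [hg, sq]),
      even (quarterTurn ^ 2 * g) (by simp [hg, sq]),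
      odd (quarterTurn ^ 3 * g) (by simp [hg, sq, pow_succ])] at this
    simpa only [pow_succ, pow_zero, one_mul, mul_inv_rev, Equiv.Perm.mul_apply, e₀, e₁, e₂, e₃,
      ← sub_eq_add_neg] using this
  have face (g : Equiv.Perm (Fin 4)) :
      γ (g⁻¹ 1) (g⁻¹ 0) - γ (g⁻¹ 3) (g⁻¹ 0) + γ (g⁻¹ 3) (g⁻¹ 2) - γ (g⁻¹ 1) (g⁻¹ 2) = 0 := by
    rcases Int.units_eq_one_or g.sign with hg | hg
    · exact face_even g hg
    · -- The even permutation `swap 0 2 * g` gives the same face with the opposite orientation.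
      have h := face_even (Equiv.swap 0 2 * g) (by simp [hg])
      simp only [mul_inv_rev, Equiv.Perm.mul_apply, Equiv.swap_inv, Equiv.swap_apply_left,
        Equiv.swap_apply_right, Equiv.swap_apply_of_ne_of_ne (show (1 : Fin 4) ≠ 0 by decide)
        (show (1 : Fin 4) ≠ 2 by decide), Equiv.swap_apply_of_ne_of_ne
        (show (3 : Fin 4) ≠ 0 by decide) (show (3 : Fin 4) ≠ 2 by decide)] at h
      rw [← neg_eq_zero, ← h]
      abel
  obtain ⟨a, b, hab⟩ := exists_potential_of_antipodal γ fun p q r t h ↦ by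
    obtain ⟨g, rfl, rfl, rfl, rfl⟩ := exists_perm p q r t h
    exact face g
  refine ⟨fun g ↦ if g.sign = 1 then a (g⁻¹ 1) else b (g⁻¹ 1), fun g ↦ ?_, fun g ↦ ?_⟩
  · rcases Int.units_eq_one_or g.sign with hg | hg
    · rw [even g hg]
      simp only [hg, sq, Equiv.Perm.sign_mul, mul_inv_rev, Equiv.Perm.mul_apply, e₁]
      simpa using hab _ _ (by simp)
    · rw [odd g hg]
      simp only [hg, sq, Equiv.Perm.sign_mul, mul_inv_rev, Equiv.Perm.mul_apply, e₁]
      rw [← hab _ _ (by simp)]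
      simp
  · have s₁ : Equiv.Perm.sign (quarterTurn * halfTurn⁻¹) = 1 := by decide
    have s₂ : ((quarterTurn * halfTurn⁻¹)⁻¹ : Equiv.Perm (Fin 4)) 1 = 1 := by decide
    simp only [Equiv.Perm.sign_mul _ g, s₁, one_mul, mul_inv_rev _ g, Equiv.Perm.mul_apply g⁻¹,
      s₂]

end OctahedralGroup

/-! ### The order of `H⁴(S₄, ℂˣ)` -/

lemma exists_nsmul_eq_additive_units {n : ℕ} (hn : 0 < n) (m : Additive ℂˣ) :
    ∃ m' : Additive ℂˣ, n • m' = m := by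
  obtain ⟨w, hw⟩ := IsAlgClosed.exists_pow_nat_eq (m.toMul : ℂ) hn
  have hw0 : w ≠ 0 := by
    rintro rfl
    exact m.toMul.ne_zero (by rw [← hw, zero_pow hn.ne'])
  exact ⟨Additive.ofMul (Units.mk0 w hw0), Additive.toMul.injective (Units.ext (by simpa using hw))⟩

open SphereComplex in
/-- Vertices have finite cyclic stabilizers and edges and faces have trivial ones, so that the
complex of functions on the cells is acyclic in the degrees needed for dimension shifting as soon
as `M` is divisible. -/
theorem exists_surjective_H1_H4 {G : Type} [Group G] [Finite G] {M : Type} [AddCommGroup M]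
    (hM : ∀ n : ℕ, 0 < n → ∀ m : M, ∃ m' : M, n • m' = m)
    {x z : G} (hxz : Subgroup.closure {x, z} = ⊤) (hz : z * z = 1) {n : ℕ} (hx : x ^ n = 1)
    (H : ∀ β : G → M, (∀ g, β (z * g) = -β g) → (∀ g, ∑ i ∈ Finset.range n, β (x ^ i * g) = 0) →
      ∃ f : G → M, (∀ g, f (x * g) - f g = β g) ∧ ∀ g, f (x * z⁻¹ * g) = f g) :
    ∃ φ : groupCohomology (Rep.trivial ℤ G M) 1 →ₗ[ℤ] groupCohomology (Rep.trivial ℤ G M) 4,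
      Function.Surjective φ := by
  have := Fintype.ofFinite G
  have even4 : Even 4 := by decide
  have hV (g : G) := groupCohomology.isZero_coind_zpowers g M (hM _ (orderOf_pos g)) 4 even4
  exact groupCohomology.exists_surjective_of_exact
    (Rep.ofHom (augmentation M x z)) (Rep.ofHom (dVertex M x z)) (Rep.ofHom (dEdge M x z))
    (Rep.ofHom (integral M)) augmentation_injective (exact_augmentation hxz)
    (exact_dVertex hz n hx H) (exact_integral hxz) integral_surjective 1
    (groupCohomology.isZero_prod (hV _) (groupCohomology.isZero_prod (hV _) (hV _)))
    (groupCohomology.isZero_prod (groupCohomology.isZero_coind_bot M 2)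
      (groupCohomology.isZero_coind_bot M 2))
    (groupCohomology.isZero_coind_bot M 1)

lemma perm_monoidHom_ext {n : ℕ} {A : Type*} [CommGroup A] {f f' : Equiv.Perm (Fin (n + 2)) →* A}
    (h : f (Equiv.swap 0 1) = f' (Equiv.swap 0 1)) : f = f' := by
  refine MonoidHom.eq_of_eqOn_dense Equiv.Perm.closure_isSwap ?_
  rintro _ ⟨i, j, hij, rfl⟩
  have hc := Equiv.Perm.isConj_swap hij (show (0 : Fin (n + 2)) ≠ 1 by simp)
  rw [isConj_iff_eq.1 (f.map_isConj hc), isConj_iff_eq.1 (f'.map_isConj hc), h]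

/-- Besides `0`, the only class in `H¹(Sₘ, ℂˣ)` is that of the sign character. -/
theorem exists_forall_H1_eq_or_eq {n : ℕ} :
    ∃ s : groupCohomology (trivialCUnits (Equiv.Perm (Fin (n + 2)))) 1, ∀ x, x = 0 ∨ x = s := by
  let e := groupCohomology.H1IsoOfIsTrivial (trivialCUnits (Equiv.Perm (Fin (n + 2))))
  by_cases h : ∃ s, s ≠ (0 : groupCohomology (trivialCUnits (Equiv.Perm (Fin (n + 2)))) 1)
  · obtain ⟨s, hs⟩ := h
    have key (x : groupCohomology (trivialCUnits (Equiv.Perm (Fin (n + 2)))) 1) :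
        ∃ f : Equiv.Perm (Fin (n + 2)) →* ℂˣ, e.hom.hom x = MonoidHom.toAdditive f :=
      ⟨MonoidHom.toAdditive.symm (e.hom.hom x), rfl⟩
    have val (f : Equiv.Perm (Fin (n + 2)) →* ℂˣ) :
        f (Equiv.swap 0 1) = 1 ∨ f (Equiv.swap 0 1) = -1 := by
      have : f (Equiv.swap 0 1) ^ 2 = 1 := by rw [← map_pow, sq, Equiv.swap_mul_self, map_one]
      have h : (f (Equiv.swap 0 1) : ℂ) ^ 2 = 1 := by rw [← Units.val_pow_eq_pow_val, this]; rfl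
      exact (sq_eq_one_iff.1 h).imp Units.ext Units.ext
    have inj : Function.Injective e.hom.hom := e.toLinearEquiv.injective
    have nz {x} (hx : x ≠ 0) : ∃ f : Equiv.Perm (Fin (n + 2)) →* ℂˣ,
        e.hom.hom x = MonoidHom.toAdditive f ∧ f (Equiv.swap 0 1) = -1 := by
      obtain ⟨f, hf⟩ := key x
      refine ⟨f, hf, (val f).resolve_left fun h ↦ hx (inj ?_)⟩
      rw [hf, perm_monoidHom_ext (f := f) (f' := 1) (by simpa using h), map_zero]
      rfl
    refine ⟨s, fun x ↦ or_iff_not_imp_left.2 fun hx ↦ inj ?_⟩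
    obtain ⟨f, hf, hf'⟩ := nz hx
    obtain ⟨g, hg, hg'⟩ := nz hs
    rw [hf, hg, perm_monoidHom_ext (hf'.trans hg'.symm)]
  · push Not at h
    exact ⟨0, fun x ↦ Or.inl (h x)⟩

theorem eq_of_H4_ne_zero {x y : groupCohomology (trivialCUnits (Equiv.Perm (Fin 4))) 4}
    (hx : x ≠ 0) (hy : y ≠ 0) : x = y := by
  obtain ⟨φ, hφ⟩ := exists_surjective_H1_H4 (M := Additive ℂˣ)
    (fun _ ↦ exists_nsmul_eq_additive_units) OctahedralGroup.closure_turns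
    (Equiv.swap_mul_self 0 1) (n := 4) (by decide) OctahedralGroup.exists_potential
  obtain ⟨s, hs⟩ := exists_forall_H1_eq_or_eq (n := 2)
  have key {z} (hz : z ≠ 0) : z = φ s := by
    obtain ⟨t, rfl⟩ := hφ z
    rcases hs t with rfl | rfl
    · exact absurd (map_zero φ) hz
    · rfl
  rw [key hx, key hy]

/-! ### Detection of classes of degree four by shuffle cycles -/

namespace groupCohomology

variable {G M : Type} [Group G] [AddCommGroup M]

lemma d_trivial_three (h : (Fin 3 → G) → M) (g₀ g₁ g₂ g₃ : G) :
    inhomogeneousCochains.d (Rep.trivial ℤ G M) 3 h ![g₀, g₁, g₂, g₃] =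
      h ![g₁, g₂, g₃] - h ![g₀ * g₁, g₂, g₃] + h ![g₀, g₁ * g₂, g₃] - h ![g₀, g₁, g₂ * g₃]
        + h ![g₀, g₁, g₂] := by
  have e₀ : (fun i : Fin 3 ↦ ![g₀, g₁, g₂, g₃] i.succ) = ![g₁, g₂, g₃] := by
    funext i; fin_cases i <;> rfl
  have e₁ : Fin.contractNth (0 : Fin 4) (· * ·) ![g₀, g₁, g₂, g₃] = ![g₀ * g₁, g₂, g₃] := by
    funext i; fin_cases i <;> rfl
  have e₂ : Fin.contractNth (1 : Fin 4) (· * ·) ![g₀, g₁, g₂, g₃] = ![g₀, g₁ * g₂, g₃] := by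
    funext i; fin_cases i <;> rfl
  have e₃ : Fin.contractNth (2 : Fin 4) (· * ·) ![g₀, g₁, g₂, g₃] = ![g₀, g₁, g₂ * g₃] := by
    funext i; fin_cases i <;> rfl
  have e₄ : Fin.contractNth (3 : Fin 4) (· * ·) ![g₀, g₁, g₂, g₃] = ![g₀, g₁, g₂] := by
    funext i; fin_cases i <;> rfl
  rw [inhomogeneousCochains.d_hom_apply, Fin.sum_univ_four, e₀, e₁, e₂, e₃, e₄]
  simp [pow_succ]
  abel

/-- Evaluation of a 4-cochain on the shuffle product of the 1-chain `[a]` with the 3-chain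
`[b|b|b] + [b|1|b]`. -/
def shuffle (a b : G) (f : (Fin 4 → G) → M) : M :=
  f ![a, b, b, b] - f ![b, a, b, b] + f ![b, b, a, b] - f ![b, b, b, a] +
    (f ![a, b, 1, b] - f ![b, a, 1, b] + f ![b, 1, a, b] - f ![b, 1, b, a])

/-- If `b` is an involution, then `[b|b|b] + [b|1|b]` is a cycle; if moreover `b` commutes with
`a`, then so is its shuffle product with `[a]`, and coboundaries vanish on it. -/
lemma shuffle_d {a b : G} (hb : b * b = 1) (hab : a * b = b * a)
    (h : (Fin 3 → G) → M) :
    shuffle a b (inhomogeneousCochains.d (Rep.trivial ℤ G M) 3 h) = 0 := by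
  have D := d_trivial_three h
  unfold shuffle
  rw [D, D, D, D, D, D, D, D]
  simp only [hb, hab, one_mul, mul_one]
  abel

lemma exists_d_eq_of_π_eq_zero {A : Rep.{0} ℤ G} {n : ℕ} (x : cocycles A (n + 1))
    (hx : π A (n + 1) x = 0) :
    ∃ h : (Fin n → G) → A, inhomogeneousCochains.d A n h = iCocycles A (n + 1) x := by
  let K := inhomogeneousCochains A
  have ex : (ShortComplex.mk (K.toCycles n (n + 1)) (K.homologyπ (n + 1))
      (K.toCycles_comp_homologyπ n (n + 1))).Exact :=
    ShortComplex.exact_of_g_is_cokernel _ (K.homologyIsCokernel n (n + 1) (by simp))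
  obtain ⟨h, hh⟩ := (ShortComplex.moduleCat_exact_iff _).1 ex x hx
  refine ⟨h, ?_⟩
  rw [← hh]
  have := ConcreteCategory.congr_hom (K.toCycles_i n (n + 1)) h
  rw [ConcreteCategory.comp_apply] at this
  refine Eq.trans ?_ this.symm
  rw [← inhomogeneousCochains.d_def]

/-- A class is nonzero on a subgroup if it is nonzero on a shuffle cycle of this subgroup. -/
lemma map_subtype_ne_zero (K : Subgroup G) {a b : K} (hb : b * b = 1) (hab : a * b = b * a)
    (f : (Fin 4 → G) → M) (hf : inhomogeneousCochains.d (Rep.trivial ℤ G M) 4 f = 0)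
    (hs : shuffle (a : G) (b : G) f ≠ 0) :
    map K.subtype (Rep.ofHom (Representation.IntertwiningMap.id (Rep.trivial ℤ K M).ρ) :
      Rep.res K.subtype (Rep.trivial ℤ G M) ⟶ Rep.trivial ℤ K M) 4
      (π (Rep.trivial ℤ G M) 4 (cocyclesMk f hf)) ≠ 0 := by
  intro h0
  rw [π_map_apply] at h0
  obtain ⟨h, hh⟩ := exists_d_eq_of_π_eq_zero _ h0
  have key : inhomogeneousCochains.d (Rep.trivial ℤ K M) 3 h =
      fun g : Fin 4 → K ↦ f fun i ↦ (g i : G) := by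
    rw [hh]
    have := ConcreteCategory.congr_hom (HomologicalComplex.cyclesMap_i (cochainsMap K.subtype
      (Rep.ofHom (Representation.IntertwiningMap.id (Rep.trivial ℤ K M).ρ) :
      Rep.res K.subtype (Rep.trivial ℤ G M) ⟶ Rep.trivial ℤ K M)) 4) (cocyclesMk f hf)
    rw [ConcreteCategory.comp_apply, ConcreteCategory.comp_apply] at this
    refine this.trans ?_
    rw [iCocycles_mk]
    rfl
  have := shuffle_d hb hab h
  rw [key] at this
  apply hs
  rw [← this]
  have e (p q r s : K) : (fun i ↦ ((![p, q, r, s] : Fin 4 → K) i : G)) = ![(p : G), q, r, s] := by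
    funext i; fin_cases i <;> rfl
  simp only [shuffle, e, Subgroup.coe_one]

end groupCohomology

/-! ### The extension of `S₄` by `{±1}` from the projective line over `𝔽₃` -/

namespace ProjectiveLine

/-- Representatives in `𝔽₃²` of the four points of the projective line over `𝔽₃`. -/
def point : Fin 4 → Fin 2 → ZMod 3 := ![![1, 0], ![0, 1], ![1, 1], ![1, 2]]

/-- A matrix over `𝔽₃` that permutes the four points of the projective line as `g` does; it
realizes the isomorphism of `S₄` with `PGL₂(𝔽₃)`. The first two columns are prescribed up to sign by
the images of the first two points, their relative sign by the image of the third one. -/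
def lift (g : Equiv.Perm (Fin 4)) : Matrix (Fin 2) (Fin 2) (ZMod 3) :=
  let u := point (g 0)
  let v := point (g 1)
  if u + v = point (g 2) ∨ u + v = -point (g 2) then !![u 0, v 0; u 1, v 1]
  else !![u 0, -v 0; u 1, -v 1]

set_option maxRecDepth 100000 in
lemma lift_mul (g h : Equiv.Perm (Fin 4)) :
    lift g * lift h = lift (g * h) ∨ lift g * lift h = - lift (g * h) := by
  revert g h; decide +kernel

lemma lift_ne_zero : ∀ g, lift g ≠ 0 := by decide

/-- The 2-cocycle with values in `ℤ/2` of the extension of `S₄ = PGL₂(𝔽₃)` by `{±1}` given by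
`GL₂(𝔽₃)`. -/
def factorSet (g h : Equiv.Perm (Fin 4)) : ZMod 2 :=
  if lift g * lift h = lift (g * h) then 0 else 1

/-- The isomorphism of `ℤ/2` with `{±1}`. -/
def zmodSign (a : ZMod 2) : ℤˣ := if a = 0 then 1 else -1

lemma zmodSign_add : ∀ a b, zmodSign (a + b) = zmodSign a * zmodSign b := by decide

lemma lift_mul_eq (g h : Equiv.Perm (Fin 4)) :
    lift g * lift h = zmodSign (factorSet g h) • lift (g * h) := by
  unfold factorSet
  split_ifs with hgh
  · simp [zmodSign, hgh]
  · simp [zmodSign, (lift_mul g h).resolve_left hgh]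

lemma zmodSign_smul_inj {a b : ZMod 2} (g : Equiv.Perm (Fin 4))
    (h : zmodSign a • lift g = zmodSign b • lift g) : a = b := by
  have hne : ∀ a : ZMod 2, a ≠ 0 → a = 1 := by decide
  have hneg : lift g ≠ -lift g := fun h ↦ by
    refine lift_ne_zero g (Matrix.ext fun i j ↦ ?_)
    have h3 : ∀ t : ZMod 3, t = -t → t = 0 := by decide
    exact h3 _ (congrFun (congrFun h i) j)
  by_cases ha : a = 0 <;> by_cases hb : b = 0
  · rw [ha, hb]
  · exact absurd (by simpa [zmodSign, ha, hb] using h) hneg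
  · exact absurd (by simpa [zmodSign, ha, hb] using h.symm) hneg
  · rw [hne a ha, hne b hb]

lemma factorSet_cocycle (g h k : Equiv.Perm (Fin 4)) :
    factorSet h k + factorSet g (h * k) = factorSet g h + factorSet (g * h) k := by
  refine zmodSign_smul_inj (g * h * k) ?_
  have := mul_assoc (lift g) (lift h) (lift k)
  simp only [lift_mul_eq, smul_mul_assoc, mul_smul_comm, smul_smul, ← mul_assoc] at this
  rw [zmodSign_add, zmodSign_add, ← this]

end ProjectiveLine

/-! ### A class with nonzero restriction -/

/-- The sign of a permutation, written additively. -/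
def parity (g : Equiv.Perm (Fin 4)) : ZMod 2 := if g.sign = 1 then 0 else 1

lemma parity_mul (g h : Equiv.Perm (Fin 4)) : parity (g * h) = parity g + parity h := by
  rcases Int.units_eq_one_or g.sign with hg | hg <;>
    rcases Int.units_eq_one_or h.sign with hh | hh <;> simp [parity, hg, hh]
  decide

/-- The cup product of `s ∪ s`, for a homomorphism `s` to `ℤ/2`, with a 2-cocycle `c` is a
cocycle. -/
lemma d_cup_eq_zero {G M : Type} [Group G] [AddCommGroup M] (e : ZMod 2 →+ M) (s : G → ZMod 2)
    (hs : ∀ g h, s (g * h) = s g + s h) (c : G → G → ZMod 2)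
    (hc : ∀ g h k, c h k + c g (h * k) = c g h + c (g * h) k) :
    inhomogeneousCochains.d (Rep.trivial ℤ G M) 4
      (fun g ↦ e (s (g 0) * s (g 1) * c (g 2) (g 3))) = 0 := by
  funext g
  rw [inhomogeneousCochains.d_hom_apply, Fin.sum_univ_five]
  change e (s (g 1) * s (g 2) * c (g 3) (g 4)) +
    ((-1 : ℤ) ^ 1 • e (s (g 0 * g 1) * s (g 2) * c (g 3) (g 4)) +
     (-1 : ℤ) ^ 2 • e (s (g 0) * s (g 1 * g 2) * c (g 3) (g 4)) +
     (-1 : ℤ) ^ 3 • e (s (g 0) * s (g 1) * c (g 2 * g 3) (g 4)) +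
     (-1 : ℤ) ^ 4 • e (s (g 0) * s (g 1) * c (g 2) (g 3 * g 4)) +
     (-1 : ℤ) ^ 5 • e (s (g 0) * s (g 1) * c (g 2) (g 3))) = 0
  simp only [← map_zsmul, ← map_add]
  convert map_zero e
  simp only [zsmul_eq_mul, hs]
  push_cast
  linear_combination s (g 0) * s (g 1) * hc (g 2) (g 3) (g 4)

/-- The inclusion of `ℤ/2 = {±1}` into `ℂˣ`. -/
noncomputable def signUnit : ZMod 2 →+ Additive ℂˣ :=
  ZMod.lift 2 ⟨zmultiplesHom _ (Additive.ofMul (-1)), by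
    refine Additive.toMul.injective ?_
    simp⟩

lemma signUnit_one_ne_zero : signUnit 1 ≠ 0 := by
  intro h
  have h1 : signUnit 1 = Additive.ofMul (-1) := by
    have := ZMod.lift_coe 2 (⟨zmultiplesHom _ (Additive.ofMul (-1 : ℂˣ)), by
      refine Additive.toMul.injective ?_
      simp⟩ : { f : ℤ →+ Additive ℂˣ // f ((2 : ℕ) : ℤ) = 0 }) 1
    exact this.trans (one_zsmul _)
  rw [h1] at h
  have h2 : ((-1 : ℂˣ) : ℂ) = 1 := congrArg (fun m : Additive ℂˣ ↦ (m.toMul : ℂ)) h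
  norm_num at h2

open ProjectiveLine in
/-- With `s` the parity and `c` the 2-cocycle of `GL₂(𝔽₃)`, the value of `s ∪ s ∪ c` on the shuffle
cycle of `(01)` and `(23)` is the commutator of lifts of `(01)` and `(23)` to `GL₂(𝔽₃)`. It is `-1`,
the two lifts being anticommuting matrices. -/
theorem exists_resCUnits_ne_zero :
    ∃ x, (resCUnits youngSubgroupS2S2 4).hom x ≠ 0 := by
  let a : youngSubgroupS2S2 := ⟨Equiv.swap 0 1, Subgroup.subset_closure (by simp)⟩
  let b : youngSubgroupS2S2 := ⟨Equiv.swap 2 3, Subgroup.subset_closure (by simp)⟩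
  refine ⟨_, groupCohomology.map_subtype_ne_zero youngSubgroupS2S2 (a := a) (b := b)
    (Subtype.ext (Equiv.swap_mul_self _ _)) (Subtype.ext (by decide :
      (Equiv.swap 0 1 * Equiv.swap 2 3 : Equiv.Perm (Fin 4)) = Equiv.swap 2 3 * Equiv.swap 0 1))
    _ (d_cup_eq_zero signUnit parity parity_mul factorSet factorSet_cocycle) ?_⟩
  have ha : parity (Equiv.swap 0 1) = 1 := by decide
  have hb : parity (Equiv.swap 2 3) = 1 := by decide
  have h1 : parity 1 = 0 := by decide
  have hc : factorSet (Equiv.swap 0 1) (Equiv.swap 2 3) -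
      factorSet (Equiv.swap 2 3) (Equiv.swap 0 1) = 1 := by decide
  suffices h : groupCohomology.shuffle (Equiv.swap 0 1) (Equiv.swap 2 3)
      (fun g : Fin 4 → Equiv.Perm (Fin 4) ↦
        signUnit (parity (g 0) * parity (g 1) * factorSet (g 2) (g 3))) = signUnit 1 from
    h.symm ▸ signUnit_one_ne_zero
  simp [groupCohomology.shuffle, ha, hb, h1, ← map_sub, hc]

/-! ### The subgroup `⟨(12), (34)⟩` -/

theorem nonempty_youngSubgroup_mulEquiv :
    Nonempty (youngSubgroupS2S2 ≃* Equiv.Perm (Fin 2) × Equiv.Perm (Fin 2)) := by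
  let φ : Equiv.Perm (Fin 2) × Equiv.Perm (Fin 2) →* Equiv.Perm (Fin 4) :=
    (finSumFinEquiv (m := 2) (n := 2)).permCongrHom.toMonoidHom.comp
      (Equiv.Perm.sumCongrHom (Fin 2) (Fin 2))
  have hφ : Function.Injective φ :=
    (finSumFinEquiv (m := 2) (n := 2)).permCongrHom.injective.comp
      Equiv.Perm.sumCongrHom_injective
  have hr : φ.range = youngSubgroupS2S2 := by
    have h0 : φ (Equiv.swap 0 1, 1) = Equiv.swap 0 1 := by decide
    have h1 : φ (1, Equiv.swap 0 1) = Equiv.swap 2 3 := by decide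
    have hp : ∀ p : Equiv.Perm (Fin 2), p = 1 ∨ p = Equiv.swap 0 1 := by decide
    apply le_antisymm
    · rintro _ ⟨⟨p, q⟩, rfl⟩
      have hpq : ((p, q) : Equiv.Perm (Fin 2) × Equiv.Perm (Fin 2)) = (p, 1) * (1, q) := by simp
      rw [hpq, map_mul]
      refine mul_mem ?_ ?_
      · rcases hp p with rfl | rfl
        · exact φ.map_one ▸ one_mem _
        · exact h0 ▸ Subgroup.subset_closure (by simp)
      · rcases hp q with rfl | rfl
        · exact φ.map_one ▸ one_mem _
        · exact h1 ▸ Subgroup.subset_closure (by simp)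
    · refine (Subgroup.closure_le _).2 ?_
      rintro _ (rfl | rfl)
      exacts [⟨_, h0⟩, ⟨_, h1⟩]
  exact ⟨((MonoidHom.ofInjective hφ).trans (MulEquiv.subgroupCongr hr)).symm⟩

theorem lemma3p3 :
    Nonempty (youngSubgroupS2S2 ≃* Equiv.Perm (Fin 2) × Equiv.Perm (Fin 2)) ∧
      Function.Injective (resCUnits youngSubgroupS2S2 4).hom := by
  refine ⟨nonempty_youngSubgroup_mulEquiv, ?_⟩
  rw [injective_iff_map_eq_zero]
  intro x hx
  by_contra hx0
  obtain ⟨y, hy⟩ := exists_resCUnits_ne_zero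
  have hy0 : y ≠ 0 := by
    rintro rfl
    exact hy (map_zero _)
  exact hy (eq_of_H4_ne_zero hy0 hx0 ▸ hx)
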